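/- **Setting.** Let $n\ge 1$, let $x_1,\dots,x_n$ be deterministic points (possibly not distinct) of a set $\mathcal X$, let $f^\star:\mathcal X\to\mathbb R$, and let $Y_1,\dots,Y_n$ be independent integrable real random variables with $\mathbb E[Y_i]=f^\star(x_i)$ for all $i$. Put $Z=((x_i,Y_i))_{1\le i\le n}$ and, for $p\in[1,2]$, $$\sigma_p(\mathbf x)=\Big(\frac1n\sum_{i=1}^n\mathbb E\big[|Y_i-\mathbb E[Y_i]|^p\big]\Big)^{1/p}\in[0,+\infty].$$ For functions $f,g$ on $\mathcal X$ and a set $\mathcal G$ of such functions, let $\ell(f,g)=\frac1n\sum_{i=1}^n|f(x_i)-g(x_i)|$ and $\ell(f,\mathcal G)=\inf_{g\in\mathcal G}\ell(f,g)$, with $\inf\varnothing=+\infty$. Let $\mathcal F$ be a set of functions $\mathcal X\to\mathbb R$. With $\mathrm{sgn}(u)=\mathbf 1_{u>0}-\mathbf 1_{u<0}$, set for $f,g\in\mathcal F$ $$T(Z,f,g)=\sum_{i=1}^n(f(x_i)-Y_i)\,\mathrm{sgn}(f(x_i)-g(x_i)),\qquad T(Z,f)=\sup_{g\in\mathcal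 F}T(Z,f,g),$$ and, for $\mathfrak c\ge 0$, $\mathcal E_{\mathfrak c}(Z,\mathcal F)=\{f\in\mathcal F:\ T(Z,f)\le\inf_{g\in\mathcal F}T(Z,g)+\mathfrak c\}$. A class $\mathcal A$ of subsets of a set $S$ has VC-dimension at most $D$ if $|\{B\cap A:\ A\in\mathcal A\}|<2^{|B|}$ for every finite $B\subset S$ with $|B|>D$. For an integer $D\ge1$, $\mathcal O(D)$ is the set of those $\overline f\in\mathcal F$ for which the two classes $\{\{x\in\mathcal X_n: f(x)>\overline f(x)\}:\ f\in\mathcal F\}$ and $\{\{x\in\mathcal X_n: f(x)<\overline f(x)\}:\ f\in\mathcal F\}$ of subsets of $\mathcal X_n=\{x_1,\dots,x_n\}$ both have VC-dimension at most $D$. **Theorem 1.** There is a universal constant $\kappa>0$ such that the following holds for all such data. Let $\widehat f$ be a (measurable) random element of $\mathcal E_{\mathfrak c}(Z,\mathcal F)$ with $\mathfrak c\ge0$. Then for every $D\in\{1,\dots,n\}$ and every $\overline f\in\mathcal O(D)$, $$\mathbb E\big[\ell(\widehat f,\overline f)\big]\le 2\ell(f^\star,\overline f)+\kappa\inf_{p\in[1,2]}\Big[\sigma_p(\mathbf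 x)\Big(\frac Dn\Big)^{1-\frac1p}\Big]+\frac{\mathfrak c}n.$$ In particular, $$\mathbb E\big[\ell(f^\star,\widehat f)\big]\le\inf_{D\in\{1,\dots,n\}}\Big[3\ell(f^\star,\mathcal O(D))+\kappa\inf_{p\in[1,2]}\Big\{\sigma_p(\mathbf x)\Big(\frac Dn\Big)^{1-\frac1p}\Big\}\Big]+\frac{\mathfrak c}n,$$ and, when $Y_1,\dots,Y_n$ are square integrable, $$\mathbb E\big[\ell(f^\star,\widehat f)\big]\le\inf_{D\in\{1,\dots,n\}}\Big[3\ell(f^\star,\mathcal O(D))+\kappa\sqrt{\Big(\frac1n\sum_{i=1}^n\mathrm{Var}(Y_i)\Big)\frac Dn}\,\Big]+\frac{\mathfrak c}n.$$ -/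

import Mathlib

open MeasureTheory ProbabilityTheory
open scoped ENNReal NNReal

namespace FixedDesign

section VC

variable {S : Type*}

/-- The VC-dimension of a class `A` of subsets of `S` is not larger than `D`: for every finite
subset `B` of `S` with more than `D` elements, `|{B ∩ A : A in the class}| < 2 ^ |B|`. -/
def VCDimLE (A : Set (Set S)) (D : ℕ) : Prop :=
  ∀ B : Finset S, D < B.card → {C : Set S | ∃ U ∈ A, C = (B : Set S) ∩ U}.ncard < 2 ^ B.card

/-- The function `g₀` is extremal in the class `G` of functions on `S` with degree not larger
than `D`: it belongs to `G` and the classes of sets `{g > g₀}`, `g ∈ G`, and `{g < g₀}`, `g ∈ G`,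
have VC-dimension not larger than `D`. -/
def IsExtremal (G : Set (S → ℝ)) (D : ℕ) (g₀ : S → ℝ) : Prop :=
  g₀ ∈ G ∧ VCDimLE {U : Set S | ∃ g ∈ G, U = {s | g₀ s < g s}} D ∧
    VCDimLE {U : Set S | ∃ g ∈ G, U = {s | g s < g₀ s}} D

end VC

noncomputable section

variable {X : Type*} {n : ℕ}

/-- The loss `ℓ(f, g) = (1/n) ∑ |f(x_i) - g(x_i)|` attached to the design points `x`. -/
def loss (x : Fin n → X) (f g : X → ℝ) : ℝ :=
  (1 / (n : ℝ)) * ∑ i, |f (x i) - g (x i)|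

/-- `ℓ(f, G) = inf_{g ∈ G} ℓ(f, g)`, which is `∞` when `G` is empty. -/
def lossSet (x : Fin n → X) (f : X → ℝ) (G : Set (X → ℝ)) : ℝ≥0∞ :=
  ⨅ g ∈ G, ENNReal.ofReal (loss x f g)

/-- The set `O(D)` of all `f ∈ F` whose restriction to the set of design points is extremal, with
degree not larger than `D`, in the class of the restrictions of the elements of `F`. -/
def extremalSet (x : Fin n → X) (F : Set (X → ℝ)) (D : ℕ) : Set (X → ℝ) :=
  {f | f ∈ F ∧
    IsExtremal ((fun g : X → ℝ => (Set.range x).domRestrict g) '' F) D ((Set.range x).domRestrict f)}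

/-- The test statistic `T(Z, f, g)` of the data `Z = ((x_1, y_1), …, (x_n, y_n))`. -/
def testStat (x : Fin n → X) (y : Fin n → ℝ) (f g : X → ℝ) : ℝ :=
  ∑ i, (f (x i) - y i) * Real.sign (f (x i) - g (x i))

/-- `T(Z, f) = sup_{g ∈ F} T(Z, f, g)`; the supremum is over a bounded set of real numbers, by
`bddAbove_testStat`. -/
def supStat (x : Fin n → X) (y : Fin n → ℝ) (F : Set (X → ℝ)) (f : X → ℝ) : ℝ :=
  ⨆ g : F, testStat x y f g

/-- The set of the `c`-approximate minimisers over `F` of `f ↦ T(Z, f)`; the infimum is over a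
set of real numbers that is bounded below, by `bddBelow_supStat`. -/
def approxMinimisers (c : ℝ) (x : Fin n → X) (y : Fin n → ℝ) (F : Set (X → ℝ)) :
    Set (X → ℝ) :=
  {f | f ∈ F ∧ supStat x y F f ≤ (⨅ g : F, supStat x y F g) + c}

theorem bddAbove_testStat (x : Fin n → X) (y : Fin n → ℝ) (F : Set (X → ℝ)) (f : X → ℝ) :
    BddAbove (Set.range fun g : F => testStat x y f g) := by
  refine ⟨∑ i, |f (x i) - y i|, ?_⟩
  rintro _ ⟨g, rfl⟩
  refine Finset.sum_le_sum fun i _ => ?_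
  refine (le_abs_self _).trans ?_
  rw [abs_mul]
  refine mul_le_of_le_one_right (abs_nonneg _) ?_
  rcases Real.sign_apply_eq (f (x i) - (g : X → ℝ) (x i)) with h | h | h <;> simp [h]

theorem bddBelow_supStat (x : Fin n → X) (y : Fin n → ℝ) (F : Set (X → ℝ)) :
    BddBelow (Set.range fun g : F => supStat x y F g) := by
  refine ⟨0, ?_⟩
  rintro _ ⟨g, rfl⟩
  have h := le_ciSup (bddAbove_testStat x y F g) g
  simpa [testStat, supStat] using h

/-- `σ_p(x) = ((1/n) ∑ E|Y_i - E Y_i|^p)^(1/p)`, with values in `[0, ∞]`. -/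
def sigma {Ω : Type*} [MeasurableSpace Ω] (μ : Measure Ω) (Y : Fin n → Ω → ℝ) (p : ℝ) : ℝ≥0∞ :=
  ((n : ℝ≥0∞)⁻¹ * ∑ i, ∫⁻ ω, ENNReal.ofReal (|Y i ω - ∫ ω', Y i ω' ∂μ| ^ p) ∂μ) ^ (1 / p)

/-- `inf_{p ∈ [1,2]} σ_p(x) (D/n)^(1 - 1/p)`. -/
def infRate {Ω : Type*} [MeasurableSpace Ω] (μ : Measure Ω) (Y : Fin n → Ω → ℝ) (D : ℕ) : ℝ≥0∞ :=
  ⨅ p ∈ Set.Icc (1 : ℝ) 2, sigma μ Y p * ENNReal.ofReal (((D : ℝ) / n) ^ (1 - 1 / p))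

end

end FixedDesign

/-! The comparison of `fhat` with an extremal point `fbar` rests on the identity `T(f, g) + T(g, f)
= ∑ |f - g|` (`testStat_add_testStat`). For `f = fhat` and `g = fbar`, the second term is at most
`T(fbar)` and the first, by near-minimality, at most `T(fbar) + c`; hence `n ℓ(fhat, fbar) ≤ 2
T(fbar) + c`. Only the sign of `fbar - g` enters `T(fbar)`, which is therefore at most the bias `n
ℓ(fstar, fbar)` plus the largest noise sums over the index sets `{fbar < g}` and `{g < fbar}`
(`supStat_le`). Extremality says that these two families shatter no set with more than `D` elements.

It remains to bound the expected maximum of `∑ i ∈ A, ξ i` over such a family, for independent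
centred `ξ i` (`lintegral_supSum_le`). Symmetrisation leaves Rademacher sums with frozen weights `a
i`. Chaining for the measure with masses `a i ^ 2` bounds them by `25 √(D ∑ a i ^ 2)` with no
logarithm (`expect_supSum_boolSign_le_sqrt`), since a family separated at relative scale `4⁻ᵏ` has
log-cardinality `O(D (k + 1))` (`log_card_le_of_separated`). This entropy bound holds for every
choice of masses: a small set of indices meets all symmetric differences, and Sauer–Shelah counts
the traces on it. Truncating the weights turns the `ℓ²` bound into an `ℓᵖ` one
(`expect_supSum_boolSign_le_rpow`), and monotonicity of `Lᵖ` norms brings in the moments of the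
noise. -/

namespace FixedDesign

open Finset
open scoped BigOperators

/-! ### Packing numbers of VC families for weighted counting measures -/

section Packing

variable {ι κ : Type*} [DecidableEq ι]

/-- Greedy choice of a small set hitting most members of a family of sets of large weight. -/
theorem exists_card_disjoint_le [Fintype ι] (w : ι → ℝ) (hW : 0 < ∑ i, w i)
    (r : κ → Finset ι) (R : Finset κ) {ε : ℝ} (hε : ε ≤ 1)
    (hR : ∀ j ∈ R, ε * ∑ i, w i ≤ ∑ i ∈ r j, w i) (hw : ∀ i, 0 ≤ w i) (m : ℕ) :
    ∃ P : Finset ι, #P ≤ m ∧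
      (#{j ∈ R | Disjoint (r j) P} : ℝ) ≤ (1 - ε) ^ m * #R := by
  induction m with
  | zero => exact ⟨∅, by simp⟩
  | succ m ih =>
    obtain ⟨P, hP, hPR⟩ := ih
    set Q := R.filter fun j => Disjoint (r j) P with hQ
    have hsum : ε * (#Q : ℝ) * ∑ i, w i ≤ ∑ i, w i * (#{j ∈ Q | i ∈ r j} : ℝ) := by
      have h1 : ∑ i, w i * (#{j ∈ Q | i ∈ r j} : ℝ) = ∑ j ∈ Q, ∑ i ∈ r j, w i := by
        simp_rw [Finset.card_filter, Nat.cast_sum, Finset.mul_sum]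
        rw [Finset.sum_comm]
        refine Finset.sum_congr rfl fun j _ => ?_
        simp [Finset.sum_ite_mem]
      rw [h1]
      calc ε * (#Q : ℝ) * ∑ i, w i = ∑ j ∈ Q, ε * ∑ i, w i := by
            rw [Finset.sum_const, nsmul_eq_mul]; ring
        _ ≤ _ := Finset.sum_le_sum fun j hj => hR j (Finset.mem_filter.1 hj).1
    -- By `hsum`, the `w`-average over `i` of the number of surviving sets containing `i` is at
    -- least `ε * #Q`, so some `i` reaches the average.
    obtain ⟨i, hi⟩ : ∃ i, ε * (#Q : ℝ) ≤ (#{j ∈ Q | i ∈ r j} : ℝ) := by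
      by_contra! hcon
      obtain ⟨i₀, -, hi₀⟩ := Finset.exists_lt_of_sum_lt (s := univ) (f := fun _ : ι => (0 : ℝ))
        (g := w) (by simpa using hW)
      refine absurd hsum (not_le.2 ?_)
      rw [Finset.mul_sum]
      refine Finset.sum_lt_sum (fun i _ => ?_) ⟨i₀, mem_univ _, ?_⟩
      · rw [mul_comm]; exact mul_le_mul_of_nonneg_right (hcon i).le (hw i)
      · rw [mul_comm]; exact mul_lt_mul_of_pos_right (hcon i₀) hi₀
    refine ⟨insert i P, (card_insert_le _ _).trans (by omega), ?_⟩
    have h2 : R.filter (fun j => Disjoint (r j) (insert i P)) = Q.filter fun j => i ∉ r j := by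
      ext j
      simp only [hQ, mem_filter, disjoint_insert_right]
      tauto
    have h3 : (#{j ∈ Q | i ∈ r j} : ℝ) + #{j ∈ Q | i ∉ r j} = #Q := by
      exact_mod_cast Finset.card_filter_add_card_filter_not (s := Q) fun j => i ∈ r j
    rw [h2, pow_succ]
    nlinarith [mul_le_mul_of_nonneg_left hPR (sub_nonneg.2 hε)]

/-- A form of the Sauer–Shelah bound on the number of traces. -/
theorem card_image_inter_le (𝒜 : Finset (Finset ι)) {D : ℕ}
    (hD : ∀ s, 𝒜.Shatters s → #s ≤ D) (P : Finset ι) {t : ℝ} (ht : 0 < t) (ht1 : t ≤ 1) :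
    (#(𝒜.image (P ∩ ·)) : ℝ) ≤ (t ^ D)⁻¹ * Real.exp (t * #P) := by
  have h1 : (𝒜.image (P ∩ ·)).shatterer ⊆ P.powerset.filter fun s => #s ≤ D := by
    intro s hs
    rw [mem_shatterer] at hs
    have hsP : s ⊆ P := by
      obtain ⟨u, hu, hsu⟩ := hs.exists_superset
      obtain ⟨v, -, rfl⟩ := mem_image.1 hu
      exact hsu.trans inter_subset_left
    refine mem_filter.2 ⟨mem_powerset.2 hsP, hD s fun u hu => ?_⟩
    obtain ⟨v, hv, rfl⟩ := hs hu
    obtain ⟨a, ha, rfl⟩ := mem_image.1 hv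
    exact ⟨a, ha, by rw [← inter_assoc, inter_eq_left.2 hsP]⟩
  have h2 : (#(𝒜.image (P ∩ ·)) : ℝ) ≤ #(P.powerset.filter fun s => #s ≤ D) := by
    exact_mod_cast (card_le_card_shatterer _).trans (card_le_card h1)
  refine h2.trans ?_
  rw [inv_mul_eq_div, le_div_iff₀ (by positivity)]
  -- As `t ≤ 1`, each small subset counted with weight `t ^ D` weighs at most `t ^ #s`; summing over
  -- all subsets gives the binomial `(1 + t) ^ #P`.
  calc (#(P.powerset.filter fun s => #s ≤ D) : ℝ) * t ^ D
      = ∑ s ∈ P.powerset.filter (fun s => #s ≤ D), t ^ D := by simp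
    _ ≤ ∑ s ∈ P.powerset.filter (fun s => #s ≤ D), t ^ #s :=
        sum_le_sum fun s hs => pow_le_pow_of_le_one ht.le ht1 (mem_filter.1 hs).2
    _ ≤ ∑ s ∈ P.powerset, t ^ #s :=
        sum_le_sum_of_subset_of_nonneg (filter_subset _ _) fun _ _ _ => by positivity
    _ = (1 + t) ^ #P := by
        rw [add_comm, ← Finset.sum_pow_mul_eq_add_pow]; simp
    _ ≤ Real.exp t ^ #P := by
        gcongr; rw [add_comm]; exact Real.add_one_le_exp t
    _ = _ := by rw [← Real.exp_nat_mul, mul_comm]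

/-- Packing bound: a subfamily whose members are `ε`-separated for a weighted counting measure
has log-cardinality at most of order `D log (8 / ε)`. -/
theorem log_card_le_of_separated [Fintype ι] (w : ι → ℝ) (hw : ∀ i, 0 ≤ w i) (hW : 0 < ∑ i, w i)
    (𝒜 : Finset (Finset ι)) {D : ℕ} (hD : ∀ s, 𝒜.Shatters s → #s ≤ D)
    {𝒩 : Finset (Finset ι)} (h𝒩 : 𝒩 ⊆ 𝒜) (hne : 𝒩.Nonempty) {ε : ℝ} (hε : 0 < ε) (hε1 : ε ≤ 1)
    (hsep : ∀ A ∈ 𝒩, ∀ B ∈ 𝒩, A ≠ B → ε * ∑ i, w i ≤ ∑ i ∈ symmDiff A B, w i) :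
    Real.log #𝒩 ≤ 4 / 3 * D * Real.log (8 / ε) + 1 / 3 := by
  set N : ℝ := (#𝒩 : ℝ) with hN
  have hN1 : 1 ≤ N := by rw [hN]; exact_mod_cast hne.card_pos
  have hlog : 0 ≤ Real.log N := Real.log_nonneg hN1
  -- Just large enough for `(1 - ε) ^ m * N ^ 2 < 1`: then `P` meets the symmetric difference of
  -- every pair of distinct members.
  set m : ℕ := ⌊2 * Real.log N / ε⌋₊ + 1 with hm
  have hm1 : 2 * Real.log N / ε < m := by rw [hm]; push_cast; exact Nat.lt_floor_add_one _
  have hm2 : (m : ℝ) ≤ 2 * Real.log N / ε + 1 := by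
    rw [hm]; push_cast; gcongr; exact Nat.floor_le (by positivity)
  obtain ⟨P, hP, hPR⟩ := exists_card_disjoint_le w hW (fun q : Finset ι × Finset ι =>
    symmDiff q.1 q.2) 𝒩.offDiag hε1 (fun q hq => by
      obtain ⟨h1, h2, h3⟩ := mem_offDiag.1 hq
      exact hsep _ h1 _ h2 h3) hw m
  have hlt : (1 - ε) ^ m * (#𝒩.offDiag : ℝ) < 1 := by
    have h1 : (#𝒩.offDiag : ℝ) ≤ N * N := by
      rw [hN, offDiag_card]; exact_mod_cast Nat.sub_le _ _
    have h2 : (1 - ε) ^ m ≤ Real.exp (-ε * m) := by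
      rw [mul_comm, Real.exp_nat_mul]
      refine pow_le_pow_left₀ (by linarith) ?_ _
      have := Real.add_one_le_exp (-ε)
      linarith
    have h3 : Real.exp (-ε * m) < (N * N)⁻¹ := by
      have : (N * N)⁻¹ = Real.exp (-(2 * Real.log N)) := by
        rw [Real.exp_neg, two_mul, Real.exp_add, Real.exp_log (by linarith)]
      rw [this, Real.exp_lt_exp]
      rw [div_lt_iff₀ hε] at hm1
      linarith
    calc (1 - ε) ^ m * (#𝒩.offDiag : ℝ) ≤ Real.exp (-ε * m) * (N * N) := by gcongr
      _ < (N * N)⁻¹ * (N * N) := by gcongr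
      _ = 1 := inv_mul_cancel₀ (by positivity)
  have hempty : (𝒩.offDiag.filter fun q => Disjoint (symmDiff q.1 q.2) P) = ∅ := by
    rw [← card_eq_zero]
    have := hPR.trans_lt hlt
    exact Nat.lt_one_iff.1 (by exact_mod_cast this)
  have hinj : Set.InjOn (P ∩ ·) (𝒩 : Set (Finset ι)) := by
    intro A hA B hB hAB
    by_contra hne
    refine absurd hempty (Finset.nonempty_iff_ne_empty.1 ⟨(A, B), mem_filter.2
      ⟨mem_offDiag.2 ⟨hA, hB, hne⟩, disjoint_left.2 fun i hi hiP => ?_⟩⟩)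
    have h := Finset.ext_iff.1 hAB i
    simp only [mem_inter, hiP, true_and] at h
    rw [mem_symmDiff] at hi
    tauto
  -- With `t = ε / 8` the exponent `t * m` is at most `log N / 4 + 1 / 8`, so that it can be
  -- absorbed in the left-hand side after taking logarithms.
  have hcard : N ≤ ((ε / 8) ^ D)⁻¹ * Real.exp (ε / 8 * m) := by
    calc N = (#(𝒩.image (P ∩ ·)) : ℝ) := by rw [card_image_of_injOn hinj]
      _ ≤ (#(𝒜.image (P ∩ ·)) : ℝ) := by
          exact_mod_cast card_le_card (image_subset_image h𝒩)
      _ ≤ ((ε / 8) ^ D)⁻¹ * Real.exp (ε / 8 * #P) :=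
          card_image_inter_le 𝒜 hD P (by positivity) (by linarith)
      _ ≤ _ := by gcongr
  have hfin := Real.log_le_log (by linarith) hcard
  rw [Real.log_mul (by positivity) (by positivity), Real.log_exp, ← inv_pow, Real.log_pow,
    inv_div] at hfin
  have h5 : ε / 8 * m ≤ Real.log N / 4 + 1 / 8 := by
    calc ε / 8 * m ≤ ε / 8 * (2 * Real.log N / ε + 1) := by gcongr
      _ = Real.log N / 4 + ε / 8 := by field_simp; ring
      _ ≤ _ := by linarith
  nlinarith

/-- Every family contains a maximal separated subfamily, which is a net. -/
theorem exists_separated_net (w : ι → ℝ) (𝒜 : Finset (Finset ι)) {δ : ℝ} (hδ : 0 ≤ δ) :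
    ∃ 𝒩 ⊆ 𝒜, (∀ A ∈ 𝒩, ∀ B ∈ 𝒩, A ≠ B → δ < ∑ i ∈ symmDiff A B, w i) ∧
      ∀ A ∈ 𝒜, ∃ B ∈ 𝒩, ∑ i ∈ symmDiff A B, w i ≤ δ := by
  obtain ⟨𝒩, h𝒩, hmax⟩ := (𝒜.powerset.filter fun 𝒩 => ∀ A ∈ 𝒩, ∀ B ∈ 𝒩, A ≠ B →
    δ < ∑ i ∈ symmDiff A B, w i).exists_max_image card ⟨∅, by simp⟩
  obtain ⟨h1, h2⟩ := mem_filter.1 h𝒩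
  refine ⟨𝒩, mem_powerset.1 h1, h2, fun A hA => ?_⟩
  by_contra! hcon
  have hA𝒩 : A ∉ 𝒩 := fun h => by
    have := hcon A h
    simp at this
    linarith
  have := hmax (insert A 𝒩) (mem_filter.2 ⟨mem_powerset.2 (insert_subset hA (mem_powerset.1 h1)),
    fun B hB C hC hBC => ?_⟩)
  · rw [card_insert_of_notMem hA𝒩] at this
    omega
  · rcases mem_insert.1 hB with rfl | hB' <;> rcases mem_insert.1 hC with rfl | hC'
    · exact absurd rfl hBC
    · exact hcon _ hC'
    · rw [symmDiff_comm]; exact hcon _ hB'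
    · exact h2 _ hB' _ hC' hBC

end Packing

/-! ### Maximal partial sums over a family of sets -/

section SupSum

variable {ι : Type*}

/-- The largest partial sum of `b` over the sets of the family. -/
def supSum (𝒜 : Finset (Finset ι)) (hne : 𝒜.Nonempty) (b : ι → ℝ) : ℝ :=
  𝒜.sup' hne fun A => ∑ i ∈ A, b i

theorem sum_le_supSum {𝒜 : Finset (Finset ι)} {A : Finset ι} (hA : A ∈ 𝒜) (b : ι → ℝ) :
    ∑ i ∈ A, b i ≤ supSum 𝒜 ⟨A, hA⟩ b :=
  le_sup' (fun A => ∑ i ∈ A, b i) hA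

theorem sum_sub_sum_symmDiff [DecidableEq ι] (A B : Finset ι) (f : ι → ℝ) :
    ∑ i ∈ A, f i - ∑ i ∈ B, f i = ∑ i ∈ A \ B, f i - ∑ i ∈ B \ A, f i := by
  have h1 := sum_inter_add_sum_sdiff A B f
  have h2 := sum_inter_add_sum_sdiff B A f
  rw [inter_comm] at h2
  linarith

theorem sum_sub_sum_le_sum_abs_symmDiff [DecidableEq ι] (A B : Finset ι) (f : ι → ℝ) :
    ∑ i ∈ A, f i - ∑ i ∈ B, f i ≤ ∑ i ∈ symmDiff A B, |f i| := by
  rw [sum_sub_sum_symmDiff, symmDiff_def, sup_eq_union, sum_union disjoint_sdiff_sdiff, sub_eq_add_neg,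
    ← sum_neg_distrib]
  exact add_le_add (sum_le_sum fun i _ => le_abs_self _) (sum_le_sum fun i _ => neg_le_abs _)

end SupSum

/-! ### Rademacher sums and chaining -/

section Rademacher

variable {ι κ : Type*} [Fintype ι] [DecidableEq ι]

/-- The real sign `1` or `-1` attached to a Boolean. -/
def boolSign (b : Bool) : ℝ := if b then 1 else -1

@[simp] theorem boolSign_not (b : Bool) : boolSign (!b) = -boolSign b := by
  cases b <;> simp [boolSign]

theorem abs_boolSign (b : Bool) : |boolSign b| = 1 := by
  cases b <;> simp [boolSign]

/-- The average factorises into hyperbolic cosines, and `cosh t ≤ exp (t ^ 2 / 2)`. -/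
theorem expect_exp_sum_boolSign_le (b : ι → ℝ) :
    𝔼 s : ι → Bool, Real.exp (∑ i, boolSign (s i) * b i) ≤ Real.exp ((∑ i, b i ^ 2) / 2) := by
  have h1 : ∑ s : ι → Bool, Real.exp (∑ i, boolSign (s i) * b i)
      = ∏ i, (2 * Real.cosh (b i)) := by
    simp_rw [Real.exp_sum]
    rw [← Fintype.prod_sum fun i c => Real.exp (boolSign c * b i)]
    refine prod_congr rfl fun i _ => ?_
    simp [boolSign, Real.cosh_eq]
    ring
  rw [Fintype.expect_eq_sum_div_card, h1, prod_mul_distrib]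
  simp only [prod_const, card_univ, Fintype.card_fun, Fintype.card_bool, Nat.cast_pow,
    Nat.cast_ofNat]
  rw [mul_div_cancel_left₀ _ (by positivity), sum_div, Real.exp_sum]
  exact prod_le_prod (fun i _ => (Real.cosh_pos _).le) fun i _ => Real.cosh_le_exp_half_sq _

theorem expect_sum_boolSign (b : ι → ℝ) :
    𝔼 s : ι → Bool, ∑ i, boolSign (s i) * b i = 0 := by
  have h := Fintype.expect_equiv (Equiv.piCongrRight fun _ : ι => Equiv.boolNot)
    (fun s : ι → Bool => ∑ i, boolSign (s i) * b i)
    (fun s : ι → Bool => -∑ i, boolSign (s i) * b i) (fun s => by simp)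
  rw [expect_neg_distrib] at h
  linarith

/-- Maximal inequality for finitely many Rademacher sums. -/
theorem expect_sup'_sum_boolSign_le (𝒩 : Finset κ) (hne : 𝒩.Nonempty) (b : κ → ι → ℝ) {v l : ℝ}
    (hl : 0 < l) (hv : ∀ j ∈ 𝒩, ∑ i, b j i ^ 2 ≤ v) :
    𝔼 s : ι → Bool, 𝒩.sup' hne (fun j => ∑ i, boolSign (s i) * b j i) ≤
      Real.log #𝒩 / l + l * v / 2 := by
  set θ := Real.log #𝒩 + l ^ 2 * v / 2 with hθ
  have hpos : (0 : ℝ) < #𝒩 := by exact_mod_cast hne.card_pos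
  -- The inequality `u + 1 ≤ exp u` at `u = l * X - θ` replaces Jensen for the logarithm; `θ` makes
  -- the averaged exponentials sum to at most `1`.
  have hpt : ∀ s : ι → Bool, l * 𝒩.sup' hne (fun j => ∑ i, boolSign (s i) * b j i) ≤
      θ - 1 + ∑ j ∈ 𝒩, Real.exp (∑ i, boolSign (s i) * (l * b j i)) * Real.exp (-θ) := by
    intro s
    obtain ⟨j, hj, hj'⟩ := exists_mem_eq_sup' hne (fun j => ∑ i, boolSign (s i) * b j i)
    rw [hj', mul_sum]
    have h1 : ∑ i, l * (boolSign (s i) * b j i) = ∑ i, boolSign (s i) * (l * b j i) :=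
      sum_congr rfl fun i _ => by ring
    rw [h1]
    have h2 := Real.add_one_le_exp (∑ i, boolSign (s i) * (l * b j i) + -θ)
    rw [Real.exp_add] at h2
    have h3 := single_le_sum (f := fun j =>
      Real.exp (∑ i, boolSign (s i) * (l * b j i)) * Real.exp (-θ))
      (fun j _ => by positivity) hj
    linarith
  have h1 := expect_le_expect (s := univ) fun s _ => hpt s
  rw [← mul_expect, expect_add_distrib, Fintype.expect_const, expect_sum_comm] at h1
  have h2 : ∑ j ∈ 𝒩, 𝔼 s : ι → Bool, Real.exp (∑ i, boolSign (s i) * (l * b j i)) * Real.exp (-θ)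
      ≤ 1 := by
    calc _ ≤ ∑ j ∈ 𝒩, Real.exp (l ^ 2 * v / 2) * Real.exp (-θ) := by
          refine sum_le_sum fun j hj => ?_
          rw [← expect_mul]
          gcongr
          refine (expect_exp_sum_boolSign_le _).trans (Real.exp_le_exp.2 ?_)
          simp_rw [mul_pow]
          rw [← mul_sum]
          gcongr
          exact hv j hj
      _ = 1 := by
          rw [sum_const, nsmul_eq_mul, ← Real.exp_add, hθ]
          rw [show l ^ 2 * v / 2 + -(Real.log #𝒩 + l ^ 2 * v / 2) = -Real.log #𝒩 by ring,
            Real.exp_neg, Real.exp_log hpos, mul_inv_cancel₀ hpos.ne']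
  have h3 : Real.log #𝒩 / l + l * v / 2 = θ / l := by rw [hθ]; field_simp
  rw [h3, le_div_iff₀ hl]
  linarith

/-- Chaining bound for subfamilies separated at scale `4⁻ᵏ`. -/
theorem expect_supSum_le_of_separated (𝒜 : Finset (Finset ι)) {D : ℕ} (hD1 : 1 ≤ D)
    (hD : ∀ s, 𝒜.Shatters s → #s ≤ D) (a : ι → ℝ) (hW : 0 < ∑ i, a i ^ 2) (k : ℕ)
    (𝒩 : Finset (Finset ι)) (h𝒩 : 𝒩 ⊆ 𝒜) (hne : 𝒩.Nonempty)
    (hsep : ∀ A ∈ 𝒩, ∀ B ∈ 𝒩, A ≠ B → (1 / 4) ^ k * ∑ i, a i ^ 2 < ∑ i ∈ symmDiff A B, a i ^ 2) :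
    𝔼 s : ι → Bool, supSum 𝒩 hne (fun i => boolSign (s i) * a i) ≤
      -- The factor vanishes at `k = 0` and increases by `(4 * (k + 2) + 1 / 2) * (1 / 2) ^ k` at
      -- each step, which is exactly the cost of one link of the chain.
      √(D * ∑ i, a i ^ 2) * (25 - (8 * k + 25) * (1 / 2) ^ k) := by
  induction k generalizing 𝒩 with
  | zero =>
    obtain ⟨A, hA⟩ := hne
    have hN : 𝒩 = {A} := by
      refine eq_singleton_iff_unique_mem.2 ⟨hA, fun B hB => ?_⟩
      by_contra hBA
      refine absurd (hsep B hB A hA hBA) (not_lt.2 ?_)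
      rw [pow_zero, one_mul]
      exact sum_le_sum_of_subset_of_nonneg (subset_univ _) fun _ _ _ => sq_nonneg _
    subst hN
    have := expect_sum_boolSign fun i => if i ∈ A then a i else 0
    simp only [mul_ite, mul_zero, sum_ite_mem, univ_inter] at this
    simp [supSum, this]
  | succ k ih =>
    set W := ∑ i, a i ^ 2 with hWdef
    have hD0 : (1 : ℝ) ≤ D := by exact_mod_cast hD1
    -- The coarser net is taken in `𝒜`, not in `𝒩`; it is separated at scale `k`, as the induction
    -- hypothesis requires.
    obtain ⟨ℳ, hℳ, hℳsep, hnet⟩ := exists_separated_net (fun i => a i ^ 2) 𝒜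
      (δ := (1 / 4) ^ k * W) (by positivity)
    choose! ρ hρ hρd using hnet
    have hℳne : ℳ.Nonempty := let ⟨A, hA⟩ := hne; ⟨ρ A, hρ A (h𝒩 hA)⟩
    have ih' := ih ℳ hℳ hℳne hℳsep
    set b : Finset ι → ι → ℝ := fun A i =>
      (if i ∈ A then a i else 0) - if i ∈ ρ A then a i else 0 with hb
    have hbv : ∀ A ∈ 𝒩, ∑ i, b A i ^ 2 ≤ (1 / 4) ^ k * W := by
      intro A hA
      refine le_trans (le_of_eq ?_) (hρd A (h𝒩 hA))
      rw [← univ_inter (symmDiff A (ρ A)), ← sum_ite_mem]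
      refine sum_congr rfl fun i _ => ?_
      simp only [hb, mem_symmDiff]
      by_cases h1 : i ∈ A <;> by_cases h2 : i ∈ ρ A <;> simp [h1, h2]
    have hsplit : ∀ s : ι → Bool, supSum 𝒩 hne (fun i => boolSign (s i) * a i) ≤
        supSum ℳ hℳne (fun i => boolSign (s i) * a i) +
          𝒩.sup' hne (fun A => ∑ i, boolSign (s i) * b A i) := by
      intro s
      refine sup'_le _ _ fun A hA => ?_
      have h1 := sum_le_supSum (hρ A (h𝒩 hA)) fun i => boolSign (s i) * a i
      have h2 := le_sup' (fun A => ∑ i, boolSign (s i) * b A i) hA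
      have h3 : ∑ i, boolSign (s i) * b A i = ∑ i ∈ A, boolSign (s i) * a i -
          ∑ i ∈ ρ A, boolSign (s i) * a i := by
        simp [hb, mul_sub, sum_sub_distrib, mul_ite, sum_ite_mem]
      simp only [h3] at h2
      linarith
    have h1 := expect_le_expect (s := univ) fun s _ => hsplit s
    rw [expect_add_distrib] at h1
    have hDW : 0 < (D : ℝ) / W := by positivity
    -- Up to a factor linear in `k`, this `l` balances the entropy term, of order `D / l`, against
    -- the variance term `l * (1 / 4) ^ k * W / 2`.
    have h2 := expect_sup'_sum_boolSign_le 𝒩 hne b (v := (1 / 4) ^ k * W)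
      (l := 2 ^ k * √(D / W)) (by positivity) hbv
    have hcard : Real.log #𝒩 ≤ 4 * D * (k + 2) := by
      have h := log_card_le_of_separated (fun i => a i ^ 2) (fun i => sq_nonneg _) hW 𝒜 hD h𝒩 hne
        (ε := (1 / 4) ^ (k + 1)) (by positivity) (pow_le_one₀ (by norm_num) (by norm_num))
        fun A hA B hB hAB => (hsep A hA B hB hAB).le
      have h8 : (8 : ℝ) / (1 / 4) ^ (k + 1) = 2 ^ (2 * k + 5) := by
        rw [div_pow, one_pow, div_div_eq_mul_div, div_one,
          show (4 : ℝ) = 2 ^ 2 by norm_num, ← pow_mul]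
        ring
      rw [h8, Real.log_pow] at h
      have hl2 := Real.log_two_lt_d9
      push_cast at h
      have : 4 / 3 * (D : ℝ) * ((2 * k + 5) * Real.log 2) ≤
          4 / 3 * (D : ℝ) * ((2 * k + 5) * 0.7) := by gcongr; linarith
      nlinarith [mul_nonneg (by linarith : (0 : ℝ) ≤ D) (Nat.cast_nonneg (α := ℝ) k)]
    have hs1 : √(D / W) * W = √(D * W) := by
      rw [show (D : ℝ) * W = (D / W) * W ^ 2 by field_simp, Real.sqrt_mul hDW.le,
        Real.sqrt_sq hW.le]
    have hs2 : √(D / W) * √(D * W) = D := by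
      rw [← Real.sqrt_mul hDW.le, show (D : ℝ) / W * (D * W) = D ^ 2 by field_simp,
        Real.sqrt_sq (by linarith)]
    have h3 : Real.log #𝒩 / (2 ^ k * √(D / W)) ≤ √(D * W) * (4 * (k + 2)) * (1 / 2) ^ k := by
      rw [div_le_iff₀ (by positivity)]
      refine hcard.trans (le_of_eq ?_)
      rw [show √(D * W) * (4 * ((k : ℝ) + 2)) * (1 / 2) ^ k * (2 ^ k * √(D / W)) =
        (√(D / W) * √(D * W)) * (4 * (k + 2)) * ((1 / 2) ^ k * 2 ^ k) by ring, hs2, ← mul_pow]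
      norm_num
      ring
    have h4 : 2 ^ k * √(D / W) * ((1 / 4) ^ k * W) / 2 = √(D * W) * (1 / 2) ^ k / 2 := by
      rw [← hs1, show (1 / 2 : ℝ) ^ k = 2 ^ k * (1 / 4) ^ k by rw [← mul_pow]; norm_num]
      ring
    rw [h4] at h2
    refine h1.trans ?_
    refine (add_le_add ih' (h2.trans (add_le_add_left h3 _))).trans (le_of_eq ?_)
    push_cast
    rw [pow_succ]
    ring

/-- Rademacher sums over a class of VC dimension at most `D`, without logarithmic factor. -/
theorem expect_supSum_boolSign_le_sqrt (𝒜 : Finset (Finset ι)) (hne : 𝒜.Nonempty) {D : ℕ}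
    (hD1 : 1 ≤ D) (hD : ∀ s, 𝒜.Shatters s → #s ≤ D) (a : ι → ℝ) :
    𝔼 s : ι → Bool, supSum 𝒜 hne (fun i => boolSign (s i) * a i) ≤ 25 * √(D * ∑ i, a i ^ 2) := by
  set W := ∑ i, a i ^ 2 with hWdef
  have hW0 : 0 ≤ W := sum_nonneg fun _ _ => sq_nonneg _
  rcases hW0.eq_or_lt with hW | hW
  · have ha : ∀ i, a i = 0 := fun i => by
      have := (sum_eq_zero_iff_of_nonneg fun i _ => sq_nonneg (a i)).1 (hWdef.symm.trans hW.symm) i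
        (mem_univ _)
      simpa using this
    simp [supSum, ha, ← hW]
  -- The distance to the net of scale `k` is treated crudely by Cauchy–Schwarz; its cost, though it
  -- involves the number of indices, vanishes as `k → ∞`.
  have hbound : ∀ k : ℕ, 𝔼 s : ι → Bool, supSum 𝒜 hne (fun i => boolSign (s i) * a i) ≤
      25 * √(D * W) + √(Fintype.card ι * ((1 / 4) ^ k * W)) := by
    intro k
    obtain ⟨ℳ, hℳ, hℳsep, hnet⟩ := exists_separated_net (fun i => a i ^ 2) 𝒜
      (δ := (1 / 4) ^ k * W) (by positivity)
    choose! ρ hρ hρd using hnet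
    have hℳne : ℳ.Nonempty := let ⟨A, hA⟩ := hne; ⟨ρ A, hρ A hA⟩
    have h1 := expect_supSum_le_of_separated 𝒜 hD1 hD a hW k ℳ hℳ hℳne hℳsep
    have h2 : ∀ s : ι → Bool, supSum 𝒜 hne (fun i => boolSign (s i) * a i) ≤
        supSum ℳ hℳne (fun i => boolSign (s i) * a i) +
          √(Fintype.card ι * ((1 / 4) ^ k * W)) := by
      intro s
      refine sup'_le _ _ fun A hA => ?_
      have h3 := sum_le_supSum (hρ A hA) fun i => boolSign (s i) * a i
      have h4 := sum_sub_sum_le_sum_abs_symmDiff A (ρ A) fun i => boolSign (s i) * a i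
      simp only [abs_mul, abs_boolSign, one_mul] at h4
      have h5 : ∑ i ∈ symmDiff A (ρ A), |a i| ≤ √(Fintype.card ι * ((1 / 4) ^ k * W)) := by
        refine Real.le_sqrt_of_sq_le ((sq_sum_le_card_mul_sum_sq).trans ?_)
        simp only [sq_abs]
        gcongr
        · exact card_le_univ _
        · exact hρd A hA
      linarith
    have h6 := expect_le_expect (s := univ) fun s _ => h2 s
    rw [expect_add_distrib, Fintype.expect_const] at h6
    have h7 : √(D * W) * (25 - (8 * k + 25) * (1 / 2) ^ k) ≤ √(D * W) * 25 := by
      gcongr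
      have : (0 : ℝ) ≤ (8 * k + 25) * (1 / 2) ^ k := by positivity
      linarith
    linarith
  have hlim : Filter.Tendsto (fun k : ℕ => 25 * √(D * W) +
      √(Fintype.card ι * ((1 / 4) ^ k * W))) Filter.atTop
      (nhds (25 * √(D * W) + √(Fintype.card ι * (0 * W)))) :=
    ((((tendsto_pow_atTop_nhds_zero_of_lt_one (by norm_num) (by norm_num)).mul_const
      W).const_mul _).sqrt).const_add _
  simpa using ge_of_tendsto' hlim hbound

end Rademacher

/-! ### Truncation of the weights -/

section Truncation

variable {ι : Type*} [Fintype ι] [DecidableEq ι]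

/-- Interpolation of the Rademacher bound between the `ℓ¹` and `ℓ²` norms of the weights. -/
theorem expect_supSum_boolSign_le_rpow (𝒜 : Finset (Finset ι)) (hne : 𝒜.Nonempty) {D : ℕ}
    (hD1 : 1 ≤ D) (hD : ∀ s, 𝒜.Shatters s → #s ≤ D) (a : ι → ℝ) {p : ℝ} (hp : p ∈ Set.Icc 1 2) :
    𝔼 s : ι → Bool, supSum 𝒜 hne (fun i => boolSign (s i) * a i) ≤
      26 * ((D : ℝ) ^ (1 - 1 / p) * (∑ i, |a i| ^ p) ^ (1 / p)) := by
  have hp0 : 0 < p := by linarith [hp.1]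
  have hDpos : (0 : ℝ) < D := by exact_mod_cast hD1
  set S := ∑ i, |a i| ^ p with hS
  have hS0 : 0 ≤ S := sum_nonneg fun _ _ => by positivity
  rcases hS0.eq_or_lt with h0 | hSpos
  · have ha : ∀ i, a i = 0 := fun i => by
      have := (sum_eq_zero_iff_of_nonneg fun i _ => Real.rpow_nonneg (abs_nonneg (a i)) p).1
        (hS.symm.trans h0.symm) i (mem_univ _)
      rw [Real.rpow_eq_zero (abs_nonneg _) hp0.ne'] at this
      simpa using this
    have : (0 : ℝ) ≤ 26 * ((D : ℝ) ^ (1 - 1 / p) * S ^ (1 / p)) := by positivity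
    simpa [supSum, ha] using this
  -- At this level `∑ (|a i| / τ) ^ p = D`. The weights below `τ` then cost at most `25 * D * τ`
  -- through the `ℓ²` bound, and those above at most `D * τ` through their `ℓ¹` norm.
  set τ := (S / D) ^ (1 / p) with hτ
  have hτpos : 0 < τ := by positivity
  have hτp : τ ^ p = S / D := by
    rw [hτ, ← Real.rpow_mul (by positivity), one_div_mul_cancel hp0.ne', Real.rpow_one]
  have hu : ∑ i, (|a i| / τ) ^ p = D := by
    simp_rw [Real.div_rpow (abs_nonneg _) hτpos.le]
    rw [← sum_div, hτp, ← hS]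
    field_simp
  have hDτ : (D : ℝ) ^ (1 - 1 / p) * S ^ (1 / p) = D * τ := by
    rw [hτ, Real.div_rpow hS0 hDpos.le, Real.rpow_sub hDpos, Real.rpow_one]
    ring
  rw [hDτ]
  set b : ι → ℝ := fun i => if |a i| ≤ τ then a i else 0 with hb
  have hsmall : ∑ i, b i ^ 2 ≤ τ ^ 2 * D := by
    rw [← hu, mul_sum]
    refine sum_le_sum fun i _ => ?_
    simp only [hb]
    split_ifs with h
    · have h1 : |a i| / τ ≤ 1 := (div_le_one hτpos).2 h
      have h2 : (|a i| / τ) ^ (2 : ℝ) ≤ (|a i| / τ) ^ p := by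
        rcases (abs_nonneg (a i)).eq_or_lt with h0 | h0
        · rw [← h0, zero_div, Real.zero_rpow hp0.ne', Real.zero_rpow (by norm_num)]
        · exact Real.rpow_le_rpow_of_exponent_ge (by positivity) h1 hp.2
      rw [Real.rpow_two, div_pow, sq_abs, div_le_iff₀ (by positivity)] at h2
      linarith
    · rw [zero_pow two_ne_zero]; positivity
  have hbig : ∑ i, |a i - b i| ≤ D * τ := by
    rw [← hu, sum_mul]
    refine sum_le_sum fun i _ => ?_
    simp only [hb]
    split_ifs with h
    · rw [sub_self, abs_zero]; positivity
    · have h1 : 1 ≤ |a i| / τ := (one_le_div hτpos).2 (not_le.1 h).le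
      have h2 := Real.rpow_le_rpow_of_exponent_le h1 hp.1
      rw [Real.rpow_one, div_le_iff₀ hτpos] at h2
      simpa using h2
  have hsplit : ∀ s : ι → Bool, supSum 𝒜 hne (fun i => boolSign (s i) * a i) ≤
      supSum 𝒜 hne (fun i => boolSign (s i) * b i) + D * τ := by
    intro s
    refine sup'_le _ _ fun A hA => ?_
    have h1 := sum_le_supSum hA fun i => boolSign (s i) * b i
    have h2 : ∑ i ∈ A, boolSign (s i) * a i - ∑ i ∈ A, boolSign (s i) * b i ≤
        ∑ i, |a i - b i| := by
      rw [← sum_sub_distrib]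
      refine le_trans (sum_le_sum fun i _ => ?_)
        (sum_le_sum_of_subset_of_nonneg (subset_univ A) fun _ _ _ => abs_nonneg _)
      rw [← mul_sub]
      refine (le_abs_self _).trans_eq ?_
      rw [abs_mul, abs_boolSign, one_mul]
    linarith
  have h1 := expect_le_expect (s := univ) fun s _ => hsplit s
  rw [expect_add_distrib, Fintype.expect_const] at h1
  have h2 := expect_supSum_boolSign_le_sqrt 𝒜 hne hD1 hD b
  have h3 : √(D * ∑ i, b i ^ 2) ≤ D * τ := by
    refine Real.sqrt_le_iff.2 ⟨by positivity, ?_⟩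
    calc (D : ℝ) * ∑ i, b i ^ 2 ≤ D * (τ ^ 2 * D) := by gcongr
      _ = _ := by ring
  linarith

end Truncation

/-! ### Symmetrisation and moments -/

section Symmetrisation

variable {Ω : Type*} [MeasurableSpace Ω] {μ : Measure Ω}

theorem integrable_sup' {κ : Type*} {𝒜 : Finset κ} (hne : 𝒜.Nonempty) {f : κ → Ω → ℝ}
    (hf : ∀ k ∈ 𝒜, Integrable (f k) μ) : Integrable (fun ω => 𝒜.sup' hne fun k => f k ω) μ := by
  have h : Integrable (𝒜.sup' hne f) μ :=
    sup'_induction hne f (p := fun g => Integrable g μ) (fun _ h₁ _ h₂ => h₁.sup h₂) hf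
  convert h using 1
  ext ω
  rw [Finset.sup'_apply]

/-- Adding an independent centred process does not decrease the expected maximum. -/
theorem integral_sup'_le_of_indepFun [IsProbabilityMeasure μ] {κ : Type*} [Fintype κ]
    (𝒜 : Finset κ) (hne : 𝒜.Nonempty)
    {U V : Ω → κ → ℝ} (hUV : IndepFun U V μ) (hU : ∀ k, Integrable (fun ω => U ω k) μ)
    (hV : ∀ k, Integrable (fun ω => V ω k) μ) (hV0 : ∀ k, ∫ ω, V ω k ∂μ = 0) :
    ∫ ω, 𝒜.sup' hne (fun k => U ω k) ∂μ ≤ ∫ ω, 𝒜.sup' hne (fun k => U ω k + V ω k) ∂μ := by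
  have mU : AEMeasurable U μ := aemeasurable_pi_lambda _ fun k => (hU k).aemeasurable
  have mV : AEMeasurable V μ := aemeasurable_pi_lambda _ fun k => (hV k).aemeasurable
  have : IsProbabilityMeasure (μ.map U) := Measure.isProbabilityMeasure_map mU
  have : IsProbabilityMeasure (μ.map V) := Measure.isProbabilityMeasure_map mV
  have hprod := (indepFun_iff_map_prod_eq_prod_map_map mU mV).1 hUV
  have hU' : ∀ k, Integrable (fun u : κ → ℝ => u k) (μ.map U) := fun k =>
    (integrable_map_measure (measurable_pi_apply k).aestronglyMeasurable mU).2 (hU k)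
  have hV' : ∀ k, Integrable (fun v : κ → ℝ => v k) (μ.map V) := fun k =>
    (integrable_map_measure (measurable_pi_apply k).aestronglyMeasurable mV).2 (hV k)
  have hV0' : ∀ k, ∫ v, v k ∂(μ.map V) = 0 := fun k => by
    rw [integral_map mV (measurable_pi_apply k).aestronglyMeasurable, hV0]
  have hG : Integrable (fun z : (κ → ℝ) × (κ → ℝ) => 𝒜.sup' hne fun k => z.1 k + z.2 k)
      ((μ.map U).prod (μ.map V)) :=
    integrable_sup' hne fun k _ => ((hU' k).comp_fst _).add ((hV' k).comp_snd _)
  have hleft : ∫ ω, 𝒜.sup' hne (fun k => U ω k) ∂μ =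
      ∫ u, 𝒜.sup' hne (fun k => u k) ∂(μ.map U) :=
    (integral_map mU (integrable_sup' hne fun k _ => hU' k).aestronglyMeasurable).symm
  have hright : ∫ ω, 𝒜.sup' hne (fun k => U ω k + V ω k) ∂μ =
      ∫ z, 𝒜.sup' hne (fun k => z.1 k + z.2 k) ∂((μ.map U).prod (μ.map V)) := by
    rw [← hprod]
    rw [← hprod] at hG
    exact (integral_map (mU.prodMk mV) hG.aestronglyMeasurable).symm
  rw [hleft, hright, integral_prod _ hG]
  -- With `U` fixed, a maximum of means is at most the mean of the maximum.
  refine integral_mono (integrable_sup' hne fun k _ => hU' k) hG.integral_prod_left fun u => ?_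
  refine sup'_le _ _ fun k hk => ?_
  have hint : ∀ k, Integrable (fun v : κ → ℝ => u k + v k) (μ.map V) := fun k =>
    (integrable_const _).add (hV' k)
  calc u k = ∫ v, (u k + v k) ∂(μ.map V) := by
        rw [integral_add (integrable_const _) (hV' k), hV0']; simp
    _ ≤ _ := integral_mono (hint k) (integrable_sup' hne fun k _ => hint k) fun v =>
        le_sup' (fun k => u k + v k) hk

variable {ι : Type*}

theorem integrable_supSum {𝒜 : Finset (Finset ι)} (hne : 𝒜.Nonempty) {ξ : ι → Ω → ℝ}
    (hξ : ∀ i, Integrable (ξ i) μ) : Integrable (fun ω => supSum 𝒜 hne fun i => ξ i ω) μ :=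
  integrable_sup' hne fun A _ => integrable_finsetSum A fun i _ => hξ i

variable [Fintype ι] [DecidableEq ι] [IsProbabilityMeasure μ]

/-- The right-hand process adds `-ξ i` at the indices where `s i` is false, and these variables are
centred and independent of the others. -/
theorem integral_supSum_ite_le {𝒜 : Finset (Finset ι)} (hne : 𝒜.Nonempty) {ξ : ι → Ω → ℝ}
    (hξ : ∀ i, Integrable (ξ i) μ) (hξ0 : ∀ i, ∫ ω, ξ i ω ∂μ = 0) (hind : iIndepFun ξ μ)
    (s : ι → Bool) :
    ∫ ω, supSum 𝒜 hne (fun i => if s i then ξ i ω else 0) ∂μ ≤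
      ∫ ω, supSum 𝒜 hne (fun i => boolSign (s i) * ξ i ω) ∂μ := by
  set J : Finset ι := univ.filter fun i => s i with hJ
  have hmeas : ∀ K : Finset ι, Measurable fun (u : K → ℝ) (A : Finset ι) =>
      ∑ i ∈ A, if h : i ∈ K then u ⟨i, h⟩ else 0 := by
    intro K
    refine measurable_pi_lambda _ fun A => Finset.measurable_sum _ fun i _ => ?_
    split_ifs with h
    · exact measurable_pi_apply _
    · exact measurable_const
  have h0 := hind.indepFun_finset₀ J Jᶜ disjoint_compl_right fun i => (hξ i).aemeasurable
  have h1 := h0.comp (hmeas J) (hmeas Jᶜ).neg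
  have hint : ∀ (K : Finset ι) (A : Finset ι),
      Integrable (fun ω => ∑ i ∈ A, if i ∈ K then ξ i ω else 0) μ := fun K A =>
    integrable_finsetSum _ fun i _ => by
      split_ifs
      · exact hξ i
      · exact integrable_zero _ _ _
  have h2 := integral_sup'_le_of_indepFun 𝒜 hne h1
    (fun A => by simpa using hint J A) (fun A => by simpa using (hint Jᶜ A).neg) (fun A => by
      simp only [Function.comp_apply, Pi.neg_apply, dite_eq_ite]
      rw [integral_neg, integral_finsetSum]
      · refine neg_eq_zero.2 (sum_eq_zero fun i _ => ?_)
        split_ifs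
        · exact hξ0 i
        · simp
      · intro i _
        split_ifs
        · exact hξ i
        · exact integrable_zero _ _ _)
  refine (le_of_eq ?_).trans (h2.trans (le_of_eq ?_))
  · simp [supSum, hJ]
  · refine integral_congr_ae (Filter.Eventually.of_forall fun ω => ?_)
    simp only [supSum, Function.comp_apply, Pi.neg_apply, dite_eq_ite]
    refine sup'_congr hne rfl fun A _ => ?_
    rw [← sub_eq_add_neg, ← sum_sub_distrib]
    refine sum_congr rfl fun i _ => ?_
    cases h : s i <;> simp [hJ, h, boolSign]

/-- No independent copy is needed: `ξ` is the sum of its restrictions to `s` and to the complement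
of `s`, each dominated by a signed process. Averaging over `s` gives the factor `2`, because `s` and
its negation are equidistributed. -/
theorem integral_supSum_le_two_mul {𝒜 : Finset (Finset ι)} (hne : 𝒜.Nonempty) {ξ : ι → Ω → ℝ}
    (hξ : ∀ i, Integrable (ξ i) μ) (hξ0 : ∀ i, ∫ ω, ξ i ω ∂μ = 0) (hind : iIndepFun ξ μ) :
    ∫ ω, supSum 𝒜 hne (fun i => ξ i ω) ∂μ ≤
      2 * ∫ ω, 𝔼 s : ι → Bool, supSum 𝒜 hne (fun i => boolSign (s i) * ξ i ω) ∂μ := by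
  have hite : ∀ s : ι → Bool,
      Integrable (fun ω => supSum 𝒜 hne fun i => if s i then ξ i ω else 0) μ := fun s =>
    integrable_supSum hne fun i => by
      split_ifs
      · exact hξ i
      · exact integrable_zero _ _ _
  have hsign : ∀ s : ι → Bool,
      Integrable (fun ω => supSum 𝒜 hne fun i => boolSign (s i) * ξ i ω) μ := fun s =>
    integrable_supSum hne fun i => (hξ i).const_mul _
  have hswap : ∫ ω, 𝔼 s : ι → Bool, supSum 𝒜 hne (fun i => boolSign (s i) * ξ i ω) ∂μ =
      𝔼 s : ι → Bool, ∫ ω, supSum 𝒜 hne (fun i => boolSign (s i) * ξ i ω) ∂μ := by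
    simp_rw [Fintype.expect_eq_sum_div_card]
    rw [integral_div, integral_finsetSum _ fun s _ => hsign s]
  have hs : ∀ s : ι → Bool, ∫ ω, supSum 𝒜 hne (fun i => ξ i ω) ∂μ ≤
      ∫ ω, supSum 𝒜 hne (fun i => boolSign (s i) * ξ i ω) ∂μ +
        ∫ ω, supSum 𝒜 hne (fun i => boolSign (!s i) * ξ i ω) ∂μ := by
    intro s
    refine le_trans ?_ (add_le_add (integral_supSum_ite_le hne hξ hξ0 hind s)
      (integral_supSum_ite_le hne hξ hξ0 hind fun i => !s i))
    rw [← integral_add (hite s) (hite fun i => !s i)]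
    refine integral_mono (integrable_supSum hne hξ) ((hite s).add (hite fun i => !s i))
      fun ω => sup'_le _ _ fun A hA => ?_
    refine le_trans (le_of_eq ?_) (add_le_add (sum_le_supSum hA _) (sum_le_supSum hA _))
    rw [← sum_add_distrib]
    refine sum_congr rfl fun i _ => ?_
    cases h : s i <;> simp
  have h := expect_le_expect (s := univ) fun s _ => hs s
  have hnot := Fintype.expect_equiv (Equiv.piCongrRight fun _ : ι => Equiv.boolNot)
    (fun s : ι → Bool => ∫ ω, supSum 𝒜 hne (fun i => boolSign (!s i) * ξ i ω) ∂μ)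
    (fun s : ι → Bool => ∫ ω, supSum 𝒜 hne (fun i => boolSign (s i) * ξ i ω) ∂μ)
    (fun s => rfl)
  rw [Fintype.expect_const, expect_add_distrib, hnot] at h
  rw [hswap]
  linarith

/-- Expected supremum of a centred independent process over a class of VC dimension at most `D`. -/
theorem lintegral_supSum_le {𝒜 : Finset (Finset ι)} (h𝒜 : ∅ ∈ 𝒜) {D : ℕ}
    (hD1 : 1 ≤ D) (hD : ∀ s, 𝒜.Shatters s → #s ≤ D) {ξ : ι → Ω → ℝ}
    (hξ : ∀ i, Integrable (ξ i) μ) (hξ0 : ∀ i, ∫ ω, ξ i ω ∂μ = 0) (hind : iIndepFun ξ μ)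
    {p : ℝ} (hp : p ∈ Set.Icc 1 2) :
    ∫⁻ ω, ENNReal.ofReal (supSum 𝒜 ⟨∅, h𝒜⟩ fun i => ξ i ω) ∂μ ≤
      52 * (ENNReal.ofReal ((D : ℝ) ^ (1 - 1 / p)) *
        (∑ i, ∫⁻ ω, ENNReal.ofReal (|ξ i ω| ^ p) ∂μ) ^ (1 / p)) := by
  have hp0 : 0 < p := by linarith [hp.1]
  have hne : 𝒜.Nonempty := ⟨∅, h𝒜⟩
  -- The empty set belongs to the family, so `ENNReal.ofReal` truncates nothing.
  have hnonneg : ∀ b : ι → ℝ, 0 ≤ supSum 𝒜 hne b := fun b => by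
    simpa using sum_le_supSum h𝒜 b
  have hEint : Integrable
      (fun ω => 𝔼 s : ι → Bool, supSum 𝒜 hne (fun i => boolSign (s i) * ξ i ω)) μ := by
    simp_rw [Fintype.expect_eq_sum_div_card]
    exact (integrable_finsetSum _ fun s _ =>
      integrable_supSum hne fun i => (hξ i).const_mul _).div_const _
  have hmeas : ∀ i, AEMeasurable (fun ω => ENNReal.ofReal (|ξ i ω| ^ p)) μ := fun i =>
    ((hξ i).aemeasurable.abs.pow_const p).ennreal_ofReal
  rw [← ofReal_integral_eq_lintegral_ofReal (integrable_supSum hne hξ)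
    (Filter.Eventually.of_forall fun ω => hnonneg _)]
  calc ENNReal.ofReal (∫ ω, supSum 𝒜 hne (fun i => ξ i ω) ∂μ)
      ≤ ENNReal.ofReal (2 *
          ∫ ω, 𝔼 s : ι → Bool, supSum 𝒜 hne (fun i => boolSign (s i) * ξ i ω) ∂μ) :=
        ENNReal.ofReal_le_ofReal (integral_supSum_le_two_mul hne hξ hξ0 hind)
    _ = 2 * ∫⁻ ω, ENNReal.ofReal
          (𝔼 s : ι → Bool, supSum 𝒜 hne (fun i => boolSign (s i) * ξ i ω)) ∂μ := by
        rw [ENNReal.ofReal_mul (by norm_num), ofReal_integral_eq_lintegral_ofReal hEint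
          (Filter.Eventually.of_forall fun ω => expect_nonneg fun s _ => hnonneg _)]
        norm_num
    _ ≤ 2 * ∫⁻ ω, 26 * ENNReal.ofReal ((D : ℝ) ^ (1 - 1 / p)) *
          (∑ i, ENNReal.ofReal (|ξ i ω| ^ p)) ^ (1 / p) ∂μ := by
        gcongr with ω
        refine (ENNReal.ofReal_le_ofReal
          (expect_supSum_boolSign_le_rpow 𝒜 hne hD1 hD (fun i => ξ i ω) hp)).trans_eq ?_
        rw [ENNReal.ofReal_mul (by norm_num), ENNReal.ofReal_mul (by positivity),
          ← ENNReal.ofReal_rpow_of_nonneg (sum_nonneg fun _ _ => by positivity) (by positivity),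
          ENNReal.ofReal_sum_of_nonneg fun _ _ => by positivity, ← mul_assoc]
        norm_num
    _ = 52 * (ENNReal.ofReal ((D : ℝ) ^ (1 - 1 / p)) *
          ∫⁻ ω, (∑ i, ENNReal.ofReal (|ξ i ω| ^ p)) ^ (1 / p) ∂μ) := by
        rw [lintegral_const_mul' _ _ (ENNReal.mul_ne_top (by norm_num) ENNReal.ofReal_ne_top)]
        rw [← mul_assoc, ← mul_assoc, ← mul_assoc]
        norm_num
    _ ≤ _ := by
        gcongr
        rw [← lintegral_finsetSum' _ fun i _ => hmeas i]
        -- The `L¹` norm of the random `ℓᵖ` norm of `ξ` is at most its `Lᵖ` norm.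
        have h := eLpNorm'_le_eLpNorm'_of_exponent_le (μ := μ) zero_lt_one hp.1
          (f := fun ω => (∑ i, ENNReal.ofReal (|ξ i ω| ^ p)) ^ (1 / p))
          ((Finset.aemeasurable_fun_sum _ fun i _ => hmeas i).pow_const _).aestronglyMeasurable
        simpa [eLpNorm', ← ENNReal.rpow_mul, hp0.ne'] using h

end Symmetrisation

/-! ### Deterministic comparison with an extremal point -/

section Deterministic

variable {X : Type*} {n : ℕ}

/-- A bound on the VC dimension passes to the sets of indices of the design points. -/
theorem VCDimLE.card_le_of_shatters {x : Fin n → X} {𝒰 : Set (Set (Set.range x))} {D : ℕ}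
    (h : VCDimLE 𝒰 D) {𝒜 : Finset (Finset (Fin n))}
    (h𝒜 : ∀ A ∈ 𝒜, ∃ U ∈ 𝒰, ∀ i, i ∈ A ↔ Set.rangeFactorization x i ∈ U)
    {B : Finset (Fin n)} (hB : 𝒜.Shatters B) : #B ≤ D := by
  classical
  by_contra! hlt
  set e := Set.rangeFactorization x
  -- Repeated design points are harmless: indices with the same design point are never separated by
  -- the family, so a shattered set contains at most one of them.
  have hinj : Set.InjOn e B := by
    intro i hi j hj hij
    by_contra hne
    obtain ⟨A, hA, hAi⟩ := hB (singleton_subset_iff.2 hi)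
    obtain ⟨U, -, hU⟩ := h𝒜 A hA
    have h1 : i ∈ B ∩ A := hAi ▸ mem_singleton_self i
    have h2 : j ∉ B ∩ A := by rw [hAi, mem_singleton]; exact fun h => hne h.symm
    refine h2 (mem_inter.2 ⟨hj, (hU j).2 ?_⟩)
    rw [← hij]
    exact (hU i).1 (mem_inter.1 h1).2
  have hcard : #(B.image e) = #B := card_image_of_injOn hinj
  have hlt' := h (B.image e) (by rwa [hcard])
  refine absurd hlt' (not_lt.2 ?_)
  have hpow : (𝒫 ((B.image e : Finset _) : Set (Set.range x))).ncard = 2 ^ #(B.image e) := by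
    rw [Set.ncard_powerset _ (finite_toSet _), Set.ncard_coe_finset]
  rw [← hpow]
  refine Set.ncard_le_ncard (fun C hC => ?_) (((B.image e).finite_toSet.finite_subsets).subset ?_)
  · obtain ⟨A, hA, hAC⟩ := hB (filter_subset (fun i => e i ∈ C) B)
    obtain ⟨U, hU, hAU⟩ := h𝒜 A hA
    refine ⟨U, hU, ?_⟩
    ext y
    have key : ∀ i ∈ B, e i ∈ C ↔ e i ∈ U := fun i hi => by
      have := Finset.ext_iff.1 hAC i
      simp only [mem_inter, mem_filter, hi, true_and] at this
      rw [← this, hAU]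
    constructor
    · intro hy
      have hy' := hC hy
      obtain ⟨i, hi, rfl⟩ := mem_image.1 (mem_coe.1 hy')
      exact ⟨hy', (key i hi).1 hy⟩
    · rintro ⟨hy', hy⟩
      obtain ⟨i, hi, rfl⟩ := mem_image.1 (mem_coe.1 hy')
      exact (key i hi).2 hy
  · rintro C ⟨U, -, rfl⟩
    exact Set.inter_subset_left

open Classical in
/-- The index sets `{i | f̄(x_i) < g(x_i)}` for `g` in the class. -/
noncomputable def upperSets (x : Fin n → X) (F : Set (X → ℝ)) (fbar : X → ℝ) :
    Finset (Finset (Fin n)) :=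
  univ.filter fun A => ∃ g ∈ F, ∀ i, i ∈ A ↔ fbar (x i) < g (x i)

open Classical in
/-- The index sets `{i | g(x_i) < f̄(x_i)}` for `g` in the class. -/
noncomputable def lowerSets (x : Fin n → X) (F : Set (X → ℝ)) (fbar : X → ℝ) :
    Finset (Finset (Fin n)) :=
  univ.filter fun A => ∃ g ∈ F, ∀ i, i ∈ A ↔ g (x i) < fbar (x i)

variable {x : Fin n → X} {F : Set (X → ℝ)} {fbar : X → ℝ}

theorem mem_upperSets {A : Finset (Fin n)} :
    A ∈ upperSets x F fbar ↔ ∃ g ∈ F, ∀ i, i ∈ A ↔ fbar (x i) < g (x i) := by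
  simp [upperSets]

theorem empty_mem_upperSets (h : fbar ∈ F) : ∅ ∈ upperSets x F fbar :=
  mem_upperSets.2 ⟨fbar, h, by simp⟩

theorem mem_lowerSets {A : Finset (Fin n)} :
    A ∈ lowerSets x F fbar ↔ ∃ g ∈ F, ∀ i, i ∈ A ↔ g (x i) < fbar (x i) := by
  simp [lowerSets]

theorem empty_mem_lowerSets (h : fbar ∈ F) : ∅ ∈ lowerSets x F fbar :=
  mem_lowerSets.2 ⟨fbar, h, by simp⟩

theorem card_le_of_shatters_upperSets {D : ℕ} (h : fbar ∈ extremalSet x F D)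
    (B : Finset (Fin n)) (hB : (upperSets x F fbar).Shatters B) : #B ≤ D := by
  refine h.2.2.1.card_le_of_shatters (fun A hA => ?_) hB
  obtain ⟨g, hg, hgA⟩ := mem_upperSets.1 hA
  exact ⟨_, ⟨_, ⟨g, hg, rfl⟩, rfl⟩, hgA⟩

theorem card_le_of_shatters_lowerSets {D : ℕ} (h : fbar ∈ extremalSet x F D)
    (B : Finset (Fin n)) (hB : (lowerSets x F fbar).Shatters B) : #B ≤ D := by
  refine h.2.2.2.card_le_of_shatters (fun A hA => ?_) hB
  obtain ⟨g, hg, hgA⟩ := mem_lowerSets.1 hA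
  exact ⟨_, ⟨_, ⟨g, hg, rfl⟩, rfl⟩, hgA⟩

theorem testStat_add_testStat (x : Fin n → X) (y : Fin n → ℝ) (f g : X → ℝ) :
    testStat x y f g + testStat x y g f = ∑ i, |f (x i) - g (x i)| := by
  rw [testStat, testStat, ← sum_add_distrib]
  refine sum_congr rfl fun i _ => ?_
  rcases lt_trichotomy (f (x i) - g (x i)) 0 with h | h | h
  · rw [Real.sign_of_neg h, Real.sign_of_pos (by linarith), abs_of_neg h]; ring
  · rw [h, ← neg_sub (f (x i)) (g (x i)), h]; simp
  · rw [Real.sign_of_pos h, Real.sign_of_neg (by linarith), abs_of_pos h]; ring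

/-- Writing `fbar - y = (fbar - fstar) - (y - fstar)`, the first part costs at most its absolute
value, and the sign is constant on each of `{fbar < g}` and `{g < fbar}`. -/
theorem supStat_le (h : fbar ∈ F) (y : Fin n → ℝ) (fstar : X → ℝ) :
    supStat x y F fbar ≤ ∑ i, |fstar (x i) - fbar (x i)| +
      (supSum (upperSets x F fbar) ⟨∅, empty_mem_upperSets h⟩ (fun i => y i - fstar (x i)) +
        supSum (lowerSets x F fbar) ⟨∅, empty_mem_lowerSets h⟩
          (fun i => -(y i - fstar (x i)))) := by
  classical
  have : Nonempty F := ⟨⟨fbar, h⟩⟩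
  refine ciSup_le fun g => ?_
  have h1 := sum_le_supSum (𝒜 := upperSets x F fbar)
    (A := univ.filter fun i => fbar (x i) < (g : X → ℝ) (x i))
    (mem_upperSets.2 ⟨g, g.2, by simp⟩) fun i => y i - fstar (x i)
  have h2 := sum_le_supSum (𝒜 := lowerSets x F fbar)
    (A := univ.filter fun i => (g : X → ℝ) (x i) < fbar (x i))
    (mem_lowerSets.2 ⟨g, g.2, by simp⟩) fun i => -(y i - fstar (x i))
  refine le_trans ?_ (add_le_add_right (add_le_add h1 h2) _)
  rw [sum_filter, sum_filter, ← sum_add_distrib, ← sum_add_distrib]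
  refine sum_le_sum fun i _ => ?_
  have habs := le_abs_self (fstar (x i) - fbar (x i))
  have habs' := neg_abs_le (fstar (x i) - fbar (x i))
  rcases lt_trichotomy (fbar (x i)) ((g : X → ℝ) (x i)) with hlt | heq | hlt
  · rw [if_pos hlt, if_neg hlt.not_gt, Real.sign_of_neg (by linarith)]; linarith
  · rw [heq]; simp
  · rw [if_neg hlt.not_gt, if_pos hlt, Real.sign_of_pos (by linarith)]; linarith

theorem loss_le_of_mem_approxMinimisers {c : ℝ} {y : Fin n → ℝ} {f : X → ℝ}
    (hf : f ∈ approxMinimisers c x y F) (h : fbar ∈ F) (fstar : X → ℝ) :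
    loss x f fbar ≤ 2 * loss x fstar fbar + 2 / n *
      (supSum (upperSets x F fbar) ⟨∅, empty_mem_upperSets h⟩ (fun i => y i - fstar (x i)) +
        supSum (lowerSets x F fbar) ⟨∅, empty_mem_lowerSets h⟩
          (fun i => -(y i - fstar (x i)))) + c / n := by
  have h1 : testStat x y f fbar ≤ supStat x y F f :=
    le_ciSup (bddAbove_testStat x y F f) ⟨fbar, h⟩
  have h2 : testStat x y fbar f ≤ supStat x y F fbar :=
    le_ciSup (bddAbove_testStat x y F fbar) ⟨f, hf.1⟩
  have h3 : (⨅ g : F, supStat x y F g) ≤ supStat x y F fbar :=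
    ciInf_le (bddBelow_supStat x y F) ⟨fbar, h⟩
  have h4 := hf.2
  have h5 := supStat_le (x := x) h y fstar
  have h6 := testStat_add_testStat x y f fbar
  have h7 : ∑ i, |f (x i) - fbar (x i)| ≤ 2 * (∑ i, |fstar (x i) - fbar (x i)| +
      (supSum (upperSets x F fbar) ⟨∅, empty_mem_upperSets h⟩ (fun i => y i - fstar (x i)) +
        supSum (lowerSets x F fbar) ⟨∅, empty_mem_lowerSets h⟩
          (fun i => -(y i - fstar (x i))))) + c := by linarith
  have h8 := mul_le_mul_of_nonneg_left h7 (by positivity : (0 : ℝ) ≤ 1 / n)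
  refine h8.trans (le_of_eq ?_)
  rw [loss]
  ring

theorem loss_triangle (x : Fin n → X) (f g h : X → ℝ) :
    loss x f h ≤ loss x f g + loss x h g := by
  rw [loss, loss, loss, ← mul_add, ← sum_add_distrib]
  refine mul_le_mul_of_nonneg_left (sum_le_sum fun i _ => ?_) (by positivity)
  rw [abs_sub_comm (h (x i))]
  exact abs_sub_le _ _ _

end Deterministic

/-! ### Risk bounds -/

section Risk

variable {Ω : Type*} [MeasurableSpace Ω] {μ : Measure Ω}
  {X : Type*} {n : ℕ} {x : Fin n → X} {Y : Fin n → Ω → ℝ} {fstar : X → ℝ}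
  {F : Set (X → ℝ)} {c : ℝ} {fhat : Ω → X → ℝ}

/-- The factor `1 / n` splits into its powers `1 / p`, which normalises the moments, and `1 - 1 /
p`, which normalises `D`. -/
theorem rate_eq_sigma_mul (hn : 0 < n) (hmean : ∀ i, ∫ ω, Y i ω ∂μ = fstar (x i)) (D : ℕ) {p : ℝ}
    (hp : 1 ≤ p) :
    (n : ℝ≥0∞)⁻¹ * (ENNReal.ofReal ((D : ℝ) ^ (1 - 1 / p)) *
      (∑ i, ∫⁻ ω, ENNReal.ofReal (|Y i ω - fstar (x i)| ^ p) ∂μ) ^ (1 / p)) =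
    sigma μ Y p * ENNReal.ofReal (((D : ℝ) / n) ^ (1 - 1 / p)) := by
  have hn' : (n : ℝ≥0∞) ≠ 0 := by exact_mod_cast hn.ne'
  have hp' : 1 / p ≤ 1 := by rw [div_le_one (by linarith)]; exact hp
  simp only [sigma, hmean]
  set S := ∑ i, ∫⁻ ω, ENNReal.ofReal (|Y i ω - fstar (x i)| ^ p) ∂μ
  have hnr : (0 : ℝ) < n := by exact_mod_cast hn
  have h1 : (n : ℝ≥0∞)⁻¹ = (n : ℝ≥0∞)⁻¹ ^ (1 / p) * ENNReal.ofReal (((n : ℝ)⁻¹) ^ (1 - 1 / p)) := by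
    rw [← ENNReal.ofReal_rpow_of_nonneg (by positivity) (by linarith),
      ENNReal.ofReal_inv_of_pos hnr, ENNReal.ofReal_natCast, ← ENNReal.rpow_add _ _ (by simp)
        (by simpa using hn')]
    norm_num
  rw [ENNReal.mul_rpow_of_nonneg _ _ (by positivity : 0 ≤ 1 / p), div_eq_mul_inv (D : ℝ),
    Real.mul_rpow (by positivity) (by positivity), ENNReal.ofReal_mul (by positivity)]
  nth_rewrite 1 [h1]
  ring

variable [IsProbabilityMeasure μ]

/-- The risk bound at a given extremal point of the class. -/
theorem lintegral_loss_le (hint : ∀ i, Integrable (Y i) μ)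
    (hmean : ∀ i, ∫ ω, Y i ω ∂μ = fstar (x i)) (hind : iIndepFun Y μ)
    (hmem : ∀ᵐ ω ∂μ, fhat ω ∈ approxMinimisers c x (fun i => Y i ω) F)
    {D : ℕ} (hD : D ∈ Finset.Icc 1 n) {fbar : X → ℝ} (hfbar : fbar ∈ extremalSet x F D) :
    ∫⁻ ω, ENNReal.ofReal (loss x (fhat ω) fbar) ∂μ ≤
      2 * ENNReal.ofReal (loss x fstar fbar) + 208 * infRate μ Y D + ENNReal.ofReal (c / n) := by
  have hD1 := (Finset.mem_Icc.1 hD).1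
  have hn : 0 < n := hD1.trans (Finset.mem_Icc.1 hD).2
  have hnr : (0 : ℝ) < n := by exact_mod_cast hn
  have hF := hfbar.1
  set U : Ω → ℝ≥0∞ := fun ω => ENNReal.ofReal (supSum (upperSets x F fbar)
    ⟨∅, empty_mem_upperSets hF⟩ fun i => Y i ω - fstar (x i)) with hU
  set V : Ω → ℝ≥0∞ := fun ω => ENNReal.ofReal (supSum (lowerSets x F fbar)
    ⟨∅, empty_mem_lowerSets hF⟩ fun i => -(Y i ω - fstar (x i))) with hV
  have hξ : ∀ i, Integrable (fun ω => Y i ω - fstar (x i)) μ := fun i =>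
    (hint i).sub (integrable_const _)
  have hξ0 : ∀ i, ∫ ω, (Y i ω - fstar (x i)) ∂μ = 0 := fun i => by
    rw [integral_sub (hint i) (integrable_const _), hmean]; simp
  have hξind : iIndepFun (fun i ω => Y i ω - fstar (x i)) μ :=
    hind.comp (fun i y => y - fstar (x i)) fun i => measurable_id.sub_const _
  have hξind' : iIndepFun (fun i ω => -(Y i ω - fstar (x i))) μ :=
    hind.comp (fun i y => -(y - fstar (x i))) fun i => (measurable_id.sub_const _).neg
  have hUmeas : AEMeasurable U μ := (integrable_supSum _ hξ).aemeasurable.ennreal_ofReal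
  -- Each of the two families contributes `52`; the factor `2 / n` in front of the noise then yields
  -- `208`.
  have hrate : ∀ p ∈ Set.Icc (1 : ℝ) 2, (n : ℝ≥0∞)⁻¹ * (∫⁻ ω, U ω ∂μ + ∫⁻ ω, V ω ∂μ) ≤
      104 * (sigma μ Y p * ENNReal.ofReal (((D : ℝ) / n) ^ (1 - 1 / p))) := by
    intro p hp
    rw [← rate_eq_sigma_mul hn hmean D hp.1]
    have h1 := lintegral_supSum_le (empty_mem_upperSets hF) hD1
      (card_le_of_shatters_upperSets hfbar) hξ hξ0 hξind hp
    have h2 := lintegral_supSum_le (empty_mem_lowerSets hF) hD1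
      (card_le_of_shatters_lowerSets hfbar) (fun i => (hξ i).neg)
      (fun i => by simp only [Pi.neg_apply]; rw [integral_neg, hξ0, neg_zero]) hξind' hp
    simp only [Pi.neg_apply, abs_neg] at h2
    refine (mul_le_mul_right (add_le_add h1 h2) _).trans_eq ?_
    ring
  have hinf : (n : ℝ≥0∞)⁻¹ * (∫⁻ ω, U ω ∂μ + ∫⁻ ω, V ω ∂μ) ≤ 104 * infRate μ Y D := by
    rw [infRate, ENNReal.mul_iInf_of_ne (by norm_num) (by norm_num)]
    refine le_iInf fun p => ?_
    rw [ENNReal.mul_iInf_of_ne (by norm_num) (by norm_num)]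
    exact le_iInf fun hp => hrate p hp
  calc ∫⁻ ω, ENNReal.ofReal (loss x (fhat ω) fbar) ∂μ
      ≤ ∫⁻ ω, (2 * ENNReal.ofReal (loss x fstar fbar) + ENNReal.ofReal (c / n) +
          2 * (n : ℝ≥0∞)⁻¹ * (U ω + V ω)) ∂μ := by
        refine lintegral_mono_ae (hmem.mono fun ω hω => ?_)
        refine (ENNReal.ofReal_le_ofReal (loss_le_of_mem_approxMinimisers hω hF fstar)).trans ?_
        refine ENNReal.ofReal_add_le.trans ?_
        refine (add_le_add_left ENNReal.ofReal_add_le _).trans ?_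
        rw [ENNReal.ofReal_mul (by norm_num), ENNReal.ofReal_mul (by positivity), div_eq_mul_inv 2,
          ENNReal.ofReal_mul (by norm_num), ENNReal.ofReal_inv_of_pos hnr, ENNReal.ofReal_natCast,
          ENNReal.ofReal_ofNat, add_right_comm]
        gcongr
        exact ENNReal.ofReal_add_le
    _ = 2 * ENNReal.ofReal (loss x fstar fbar) + ENNReal.ofReal (c / n) +
          2 * ((n : ℝ≥0∞)⁻¹ * (∫⁻ ω, U ω ∂μ + ∫⁻ ω, V ω ∂μ)) := by
        rw [lintegral_add_left measurable_const, lintegral_const_mul' _ _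
          (ENNReal.mul_ne_top (by norm_num) (ENNReal.inv_ne_top.2 (by exact_mod_cast hn.ne'))),
          lintegral_add_left' hUmeas, lintegral_const, measure_univ, mul_one, mul_assoc]
    _ ≤ 2 * ENNReal.ofReal (loss x fstar fbar) + ENNReal.ofReal (c / n) +
          2 * (104 * infRate μ Y D) := by gcongr
    _ = _ := by ring

/-- The triangle inequality through `fbar` adds one bias term to the two already present; an empty
set of extremal points makes the bound infinite. -/
theorem lintegral_loss_fstar_le (hint : ∀ i, Integrable (Y i) μ)
    (hmean : ∀ i, ∫ ω, Y i ω ∂μ = fstar (x i)) (hind : iIndepFun Y μ)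
    (hmem : ∀ᵐ ω ∂μ, fhat ω ∈ approxMinimisers c x (fun i => Y i ω) F)
    {D : ℕ} (hD : D ∈ Finset.Icc 1 n) :
    ∫⁻ ω, ENNReal.ofReal (loss x fstar (fhat ω)) ∂μ ≤
      3 * lossSet x fstar (extremalSet x F D) + 208 * infRate μ Y D + ENNReal.ofReal (c / n) := by
  simp only [lossSet, ENNReal.mul_iInf_of_ne (by norm_num : (3 : ℝ≥0∞) ≠ 0) (by norm_num),
    ENNReal.iInf_add]
  refine le_iInf₂ fun fbar hfbar => ?_
  calc ∫⁻ ω, ENNReal.ofReal (loss x fstar (fhat ω)) ∂μ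
      ≤ ∫⁻ ω, (ENNReal.ofReal (loss x fstar fbar) +
          ENNReal.ofReal (loss x (fhat ω) fbar)) ∂μ :=
        lintegral_mono fun ω => (ENNReal.ofReal_le_ofReal (loss_triangle x fstar fbar _)).trans
          ENNReal.ofReal_add_le
    _ = ENNReal.ofReal (loss x fstar fbar) +
          ∫⁻ ω, ENNReal.ofReal (loss x (fhat ω) fbar) ∂μ := by
        rw [lintegral_add_left measurable_const, lintegral_const, measure_univ, mul_one]
    _ ≤ ENNReal.ofReal (loss x fstar fbar) + (2 * ENNReal.ofReal (loss x fstar fbar) +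
          208 * infRate μ Y D + ENNReal.ofReal (c / n)) := by
        gcongr
        exact lintegral_loss_le hint hmean hind hmem hD hfbar
    _ = _ := by ring

theorem infRate_le_sqrt (hL2 : ∀ i, MemLp (Y i) 2 μ) (D : ℕ) :
    infRate μ Y D ≤ ENNReal.ofReal (√((1 / (n : ℝ) * ∑ i, Var[Y i; μ]) * ((D : ℝ) / n))) := by
  refine (iInf₂_le (2 : ℝ) (by norm_num)).trans (le_of_eq ?_)
  have hvar : ∀ i, ∫⁻ ω, ENNReal.ofReal (|Y i ω - ∫ ω', Y i ω' ∂μ| ^ (2 : ℝ)) ∂μ =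
      ENNReal.ofReal Var[Y i; μ] := by
    intro i
    rw [(hL2 i).ofReal_variance_eq, evariance_eq_lintegral_ofReal]
    simp
  have hV : 0 ≤ ∑ i, Var[Y i; μ] := Finset.sum_nonneg fun i _ => variance_nonneg _ _
  -- For `n = 0` the product of `n⁻¹ = ∞` and the empty sum is `0`, so both sides vanish.
  rcases n.eq_zero_or_pos with rfl | hn
  · simp [sigma]
  have hnr : (0 : ℝ) < n := by exact_mod_cast hn
  simp only [sigma, hvar]
  rw [Real.sqrt_mul (by positivity), ENNReal.ofReal_mul (by positivity), Real.sqrt_eq_rpow,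
    Real.sqrt_eq_rpow, show (1 : ℝ) - 1 / 2 = 1 / 2 by norm_num,
    ← ENNReal.ofReal_rpow_of_nonneg (x := 1 / (n : ℝ) * _) (by positivity) (by norm_num),
    ENNReal.ofReal_mul (by positivity), one_div (n : ℝ), ENNReal.ofReal_inv_of_pos hnr,
    ENNReal.ofReal_natCast, ENNReal.ofReal_sum_of_nonneg fun i _ => variance_nonneg _ _]

end Risk

end FixedDesign

theorem theorem1 :
    ∃ κ : ℝ≥0, 0 < κ ∧
      ∀ {Ω : Type*} [MeasurableSpace Ω] (μ : Measure Ω) [IsProbabilityMeasure μ]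
        {X : Type*} (n : ℕ) (x : Fin n → X) (Y : Fin n → Ω → ℝ) (fstar : X → ℝ)
        (F : Set (X → ℝ)) (c : ℝ) (fhat : Ω → X → ℝ),
        (∀ i, Integrable (Y i) μ) →
        (∀ i, ∫ ω, Y i ω ∂μ = fstar (x i)) →
        iIndepFun Y μ →
        0 ≤ c →
        (∀ i, AEMeasurable (fun ω => fhat ω (x i)) μ) →
        (∀ᵐ ω ∂μ, fhat ω ∈ FixedDesign.approxMinimisers c x (fun i => Y i ω) F) →
        (∀ D ∈ Finset.Icc 1 n, ∀ fbar ∈ FixedDesign.extremalSet x F D,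
          ∫⁻ ω, ENNReal.ofReal (FixedDesign.loss x (fhat ω) fbar) ∂μ ≤
            2 * ENNReal.ofReal (FixedDesign.loss x fstar fbar) +
              κ * FixedDesign.infRate μ Y D + ENNReal.ofReal (c / n)) ∧
        (∫⁻ ω, ENNReal.ofReal (FixedDesign.loss x fstar (fhat ω)) ∂μ ≤
          (⨅ D ∈ Finset.Icc 1 n,
            (3 * FixedDesign.lossSet x fstar (FixedDesign.extremalSet x F D) +
              κ * FixedDesign.infRate μ Y D)) + ENNReal.ofReal (c / n)) ∧
        ((∀ i, MemLp (Y i) 2 μ) →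
          ∫⁻ ω, ENNReal.ofReal (FixedDesign.loss x fstar (fhat ω)) ∂μ ≤
            (⨅ D ∈ Finset.Icc 1 n,
              (3 * FixedDesign.lossSet x fstar (FixedDesign.extremalSet x F D) +
                κ * ENNReal.ofReal
                  (√((1 / (n : ℝ) * ∑ i, Var[Y i; μ]) * ((D : ℝ) / n))))) +
              ENNReal.ofReal (c / n)) := by
  refine ⟨208, by norm_num, ?_⟩
  intro Ω _ μ _ X n x Y fstar F c fhat hint hmean hind _ _ hmem
  have hκ : ((208 : ℝ≥0) : ℝ≥0∞) = 208 := by norm_num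
  rw [hκ]
  refine ⟨fun D hD fbar hfbar => FixedDesign.lintegral_loss_le hint hmean hind hmem hD hfbar,
    ?_, fun hL2 => ?_⟩
  · simp only [ENNReal.iInf_add]
    exact le_iInf₂ fun D hD => FixedDesign.lintegral_loss_fstar_le hint hmean hind hmem hD
  · simp only [ENNReal.iInf_add]
    refine le_iInf₂ fun D hD =>
      (FixedDesign.lintegral_loss_fstar_le hint hmean hind hmem hD).trans ?_
    gcongr
    exact FixedDesign.infRate_le_sqrt hL2 D
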